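/- Let $F$ be a field, $n\ge 1$ and $A\in M_n(F)$. For a monic polynomial $f\in F[X]$ of degree $k$ let $C_f\in M_k(F)$ be its companion matrix. A matrix is *cyclic* if it is similar to a companion matrix, and $A$ is *of polynomial type* if $A$ is a polynomial (over $F$) in a cyclic matrix of $M_n(F)$. The *elementary divisors* of $A$ are the positive powers $q_1,\dots,q_m$ of monic irreducible polynomials (unique up to order, repetitions allowed) for which $A$ is similar to $C_{q_1}\oplus\cdots\oplus C_{q_m}$. Let $\Omega\le \mathrm{GL}_2(F)$ be the group of matrices $M=\begin{pmatrix} a&b\\0&1\end{pmatrix}$ with $a\in F^*$, $b\in F$, acting on $F[X]$ by $f^M(X)=a^{-\deg f}f(aX+b)$ for $f\ne0$, and $0^M=0$; the polynomials $f^M$ are the $\Omega$-conjugates of $f$. Identify $b\in F^+$ with $\begin{pmatrix}1&b\\0&1\end{pmatrix}$ and $a\in F^*$ with $\begin{pmatrix}a&0\\0&1\end{pmatrix}$, and let $S_f$ and $T_f$ be the stabilizers of $f$ in $F^+$ and in $F^*$, respectively. For a monic irreducible factor $p$ of the minimal polynomial of $A$ let $\ell(p)$ be the number of elementary divisors of $A$,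 counted with multiplicity, that are a power of an $\Omega$-conjugate of $p$. **Theorem.** Suppose that for every monic irreducible factor $p$ of the minimal polynomial of $A$ we have $|F^+|\ge \ell(p)$ if $S_p=\{0\}$, and $|F^*|\ge\ell(p)$ if $S_p\ne\{0\}$ but $T_p=\{1\}$. Then $A$ is of polynomial type. More precisely, let $q_1,\dots,q_m$ be the elementary divisors of $A$, where $q_i=p_i^{e_i}$ with $e_i\ge 1$ and $p_i$ a monic irreducible factor of the minimal polynomial of $A$ (the $p_i$ need not be distinct). Then there are pairwise distinct polynomials $r_1,\dots,r_m$, with $r_i$ an $\Omega$-conjugate of $p_i$ for each $i$, and a polynomial $g\in F[X]$, such that $A$ is similar to $g(C_f)$ with $f=r_1^{e_1}\cdots r_m^{e_m}$. -/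

import Mathlib

open Polynomial

namespace PolynomialType

universe u

section Matrices

variable {F : Type u} [Field F]

/-- `A` and `B` are similar. The index types may differ, so that a block diagonal matrix can be
compared with an `n × n` matrix; for equal index types this is the usual notion. -/
def MatrixSimilar {ι κ : Type*} [Fintype ι] [DecidableEq ι] [Fintype κ] [DecidableEq κ]
    (A : Matrix ι ι F) (B : Matrix κ κ F) : Prop :=
  ∃ (P : Matrix ι κ F) (Q : Matrix κ ι F), P * Q = 1 ∧ Q * P = 1 ∧ A = P * B * Q

/-- The companion matrix `C_f`: ones below the diagonal, and the negatives of the coefficients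
`f₀, …, f_{n-1}` in the last column. -/
def companion (f : F[X]) : Matrix (Fin f.natDegree) (Fin f.natDegree) F :=
  Matrix.of fun i j =>
    if (j : ℕ) + 1 = f.natDegree then -f.coeff i else if (i : ℕ) = j + 1 then 1 else 0

/-- `s` is a list of elementary divisors of `A`: its members are positive powers of monic irreducible
polynomials, and `A` is similar to the direct sum of their companion matrices. -/
def IsElementaryDivisors {n : ℕ} (A : Matrix (Fin n) (Fin n) F) (s : Multiset F[X]) : Prop :=
  ∃ (m : ℕ) (q : Fin m → F[X]), s = Finset.univ.val.map q ∧
    (∀ i, ∃ (p : F[X]) (e : ℕ), p.Monic ∧ Irreducible p ∧ 0 < e ∧ q i = p ^ e) ∧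
    MatrixSimilar A (Matrix.blockDiagonal' fun i => companion (q i))

theorem companion_eq_leftMulMatrix {f : F[X]} (hf : f.Monic) :
    Algebra.leftMulMatrix (AdjoinRoot.powerBasis' hf).basis (AdjoinRoot.root f) = companion f := by
  have h := (AdjoinRoot.powerBasis' hf).leftMulMatrix
  have h1 : (AdjoinRoot.powerBasis' hf).minpolyGen = f := by
    rw [PowerBasis.minpolyGen_eq]
    change minpoly F (AdjoinRoot.root f) = f
    rw [AdjoinRoot.minpoly_root hf.ne_zero]
    simp [hf.leadingCoeff]
  rw [h1] at h
  exact h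

theorem similar_toMatrix {n : ℕ} (A : Matrix (Fin n) (Fin n) F) {κ : Type*} [Fintype κ]
    [DecidableEq κ] (b : Module.Basis κ F (Fin n → F)) :
    MatrixSimilar A (LinearMap.toMatrix b b (Matrix.toLin' A)) := by
  refine ⟨(Pi.basisFun F (Fin n)).toMatrix b, b.toMatrix (Pi.basisFun F (Fin n)), ?_, ?_, ?_⟩
  · exact Module.Basis.toMatrix_mul_toMatrix_flip _ _
  · exact Module.Basis.toMatrix_mul_toMatrix_flip _ _
  · rw [basis_toMatrix_mul_linearMap_toMatrix_mul_basis_toMatrix]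
    rw [← Matrix.toLin_eq_toLin', LinearMap.toMatrix_toLin]

theorem MatrixSimilar.trans_reindex {ι κ μ : Type*} [Fintype ι] [DecidableEq ι] [Fintype κ]
    [DecidableEq κ] [Fintype μ] [DecidableEq μ] {A : Matrix ι ι F} {B : Matrix κ κ F}
    (h : MatrixSimilar A B) (φ : μ ≃ κ) : MatrixSimilar A (B.submatrix φ φ) := by
  obtain ⟨P, Q, h1, h2, h3⟩ := h
  refine ⟨P.submatrix id φ, Q.submatrix φ id, ?_, ?_, ?_⟩
  · rw [Matrix.submatrix_mul_equiv, h1]; simp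
  · rw [← Matrix.submatrix_mul _ _ _ _ _ Function.bijective_id, h2]; simp
  · rw [Matrix.submatrix_mul_equiv, Matrix.submatrix_mul_equiv, h3]; simp

theorem similar_of_linearEquiv {n : ℕ} (A : Matrix (Fin n) (Fin n) F) {ι : Type*} [Fintype ι]
    [DecidableEq ι] (q : ι → F[X]) (hq : ∀ i, (q i).Monic)
    (L : (Fin n → F) ≃ₗ[F] ((i : ι) → AdjoinRoot (q i)))
    (hL : ∀ v i, L (A.mulVec v) i = AdjoinRoot.root (q i) * L v i) :
    MatrixSimilar A (Matrix.blockDiagonal' fun i => companion (q i)) := by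
  let pb : ∀ i, Module.Basis (Fin (q i).natDegree) F (AdjoinRoot (q i)) :=
    fun i => (AdjoinRoot.powerBasis' (hq i)).basis
  let b : Module.Basis (Σ i, Fin (q i).natDegree) F (Fin n → F) := (Pi.basis pb).map L.symm
  have hb := similar_toMatrix A b
  convert hb using 1
  ext ⟨i, x⟩ ⟨j, y⟩
  have hc : ∀ i, companion (q i) = Algebra.leftMulMatrix (pb i) (AdjoinRoot.root (q i)) :=
    fun i => (companion_eq_leftMulMatrix (hq i)).symm
  have h1 : (LinearMap.toMatrix b b (Matrix.toLin' A)) ⟨i, x⟩ ⟨j, y⟩ =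
      (pb i).repr (AdjoinRoot.root (q i) * (Pi.single j (pb j y) : ∀ i, AdjoinRoot (q i)) i) x := by
    rw [LinearMap.toMatrix_apply, Matrix.toLin'_apply]
    simp only [b, Module.Basis.map_repr, LinearEquiv.trans_apply, LinearEquiv.symm_symm,
      Pi.basis_repr, hL, Module.Basis.map_apply, LinearEquiv.apply_symm_apply, Pi.basis_apply]
  rw [h1]
  by_cases hij : i = j
  · subst hij
    rw [Matrix.blockDiagonal'_apply_eq, hc, Algebra.leftMulMatrix_eq_repr_mul, Pi.single_eq_same]
  · rw [Matrix.blockDiagonal'_apply_ne _ _ _ hij, Pi.single_eq_of_ne hij]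
    simp

theorem exists_similar_blockDiagonal {n : ℕ} (A : Matrix (Fin n) (Fin n) F) :
    ∃ (ι : Type u) (_ : Fintype ι) (_ : DecidableEq ι) (p : ι → F[X]) (e : ι → ℕ),
      (∀ i, (p i).Monic ∧ Irreducible (p i)) ∧
      MatrixSimilar A (Matrix.blockDiagonal' fun i => companion (p i ^ e i)) := by
  classical
  obtain ⟨ι, hι, p, hp, e, ⟨l⟩⟩ := Module.equiv_directSum_of_isTorsion
    (Module.AEval.isTorsion_of_finiteDimensional F (Fin n → F) (Matrix.toLin' A))
  have hm : ∀ i, (normalize (p i)).Monic := fun i => Polynomial.monic_normalize (hp i).ne_zero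
  have hspan : ∀ i, (Submodule.span F[X] {p i ^ e i} : Ideal F[X]) =
      Ideal.span {normalize (p i) ^ e i} := fun i =>
    Ideal.span_singleton_eq_span_singleton.2 ((normalize_associated (p i)).symm.pow_pow)
  let l' : Module.AEval' (Matrix.toLin' A) ≃ₗ[F[X]]
      ((i : ι) → F[X] ⧸ Ideal.span {normalize (p i) ^ e i}) :=
    (l.trans (DFinsupp.linearEquivFunOnFintype)).trans
      (LinearEquiv.piCongrRight fun i => Submodule.quotEquivOfEq _ _ (hspan i))
  let L : (Fin n → F) ≃ₗ[F] ((i : ι) → F[X] ⧸ Ideal.span {normalize (p i) ^ e i}) :=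
    (Module.AEval'.of (Matrix.toLin' A)).trans (l'.restrictScalars F)
  refine ⟨ι, hι, inferInstance, fun i => normalize (p i), e, fun i => ⟨hm i, ?_⟩,
    similar_of_linearEquiv A _ (fun i => (hm i).pow _) L ?_⟩
  · exact (normalize_associated (p i)).symm.irreducible (hp i)
  · intro v i
    have h := congrFun (l'.map_smul (X : F[X]) (Module.AEval'.of (Matrix.toLin' A) v)) i
    rw [Module.AEval'.X_smul_of] at h
    exact h

/-- Every square matrix over a field has elementary divisors. -/
theorem exists_isElementaryDivisors {n : ℕ} (A : Matrix (Fin n) (Fin n) F) :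
    ∃ s, IsElementaryDivisors A s := by
  classical
  obtain ⟨ι, _, _, p, e, hp, hs⟩ := exists_similar_blockDiagonal A
  let φ := (Fintype.equivFin {i // e i ≠ 0}).symm
  refine ⟨_, _, fun k => p (φ k) ^ e (φ k), rfl, fun k => ⟨p (φ k), e (φ k), (hp _).1, (hp _).2,
    Nat.pos_of_ne_zero (φ k).2, rfl⟩, ?_⟩
  let ψ : (Σ k, Fin (p (φ k) ^ e (φ k)).natDegree) → (Σ i, Fin (p i ^ e i).natDegree) :=
    fun x => ⟨φ x.1, x.2⟩
  have hψ : Function.Bijective ψ := by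
    constructor
    · rintro ⟨k, x⟩ ⟨l, y⟩ h
      have hkl : k = l := φ.injective (Subtype.ext (congrArg Sigma.fst h))
      subst hkl
      simpa [ψ] using h
    · rintro ⟨i, x⟩
      have hi : e i ≠ 0 := by
        intro h0
        have := x.2
        simp [h0] at this
      obtain ⟨k, hk⟩ := φ.surjective ⟨i, hi⟩
      have hk' : (φ k : ι) = i := by rw [hk]
      subst hk'
      exact ⟨⟨k, x⟩, rfl⟩
  convert hs.trans_reindex (Equiv.ofBijective ψ hψ) using 1
  ext ⟨k, x⟩ ⟨l, y⟩
  rw [Matrix.submatrix_apply]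
  simp only [Equiv.ofBijective_apply, ψ]
  by_cases hkl : k = l
  · subst hkl
    rw [Matrix.blockDiagonal'_apply_eq, Matrix.blockDiagonal'_apply_eq]
  · rw [Matrix.blockDiagonal'_apply_ne _ _ _ hkl, Matrix.blockDiagonal'_apply_ne]
    exact fun h => hkl (φ.injective (Subtype.ext h))


/-- The nullity of a square matrix. -/
noncomputable def nullity {ι : Type*} [Fintype ι] (A : Matrix ι ι F) : ℕ :=
  Module.finrank F (LinearMap.ker A.mulVecLin)

theorem aeval_C_mul_X_pow_succ {ι : Type*} [Fintype ι] [DecidableEq ι] (M : Matrix ι ι F)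
    (a : F) (n : ℕ) : aeval M (C a * X ^ (n + 1)) = aeval M (C a * X ^ n) * M := by
  rw [pow_succ, ← mul_assoc, map_mul _ _ (X : F[X]), aeval_X]

theorem MatrixSimilar.aeval {ι κ : Type*} [Fintype ι] [DecidableEq ι] [Fintype κ] [DecidableEq κ]
    {A : Matrix ι ι F} {B : Matrix κ κ F} (h : MatrixSimilar A B) (y : F[X]) :
    MatrixSimilar (aeval A y) (aeval B y) := by
  obtain ⟨P, Q, h1, h2, h3⟩ := h
  refine ⟨P, Q, h1, h2, ?_⟩
  induction y using Polynomial.induction_on with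
  | C a =>
    rw [aeval_C, aeval_C, Algebra.algebraMap_eq_smul_one, Algebra.algebraMap_eq_smul_one]
    simp [h1]
  | add f g hf hg => rw [map_add, map_add, hf, hg, Matrix.mul_add, Matrix.add_mul]
  | monomial n a h =>
    rw [aeval_C_mul_X_pow_succ, aeval_C_mul_X_pow_succ, h]
    nth_rewrite 1 [h3]
    simp only [Matrix.mul_assoc]
    rw [← Matrix.mul_assoc Q P, h2, Matrix.one_mul]

theorem MatrixSimilar.symm {ι κ : Type*} [Fintype ι] [DecidableEq ι] [Fintype κ] [DecidableEq κ]
    {A : Matrix ι ι F} {B : Matrix κ κ F} (h : MatrixSimilar A B) : MatrixSimilar B A := by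
  obtain ⟨P, Q, h1, h2, h3⟩ := h
  refine ⟨Q, P, h2, h1, ?_⟩
  rw [h3]
  simp only [Matrix.mul_assoc]
  rw [h2, Matrix.mul_one, ← Matrix.mul_assoc, h2, Matrix.one_mul]

theorem MatrixSimilar.nullity_le {ι κ : Type*} [Fintype ι] [DecidableEq ι] [Fintype κ] [DecidableEq κ]
    {A : Matrix ι ι F} {B : Matrix κ κ F} (h : MatrixSimilar A B) : nullity A ≤ nullity B := by
  obtain ⟨P, Q, h1, h2, h3⟩ := h
  have hm : ∀ v ∈ LinearMap.ker A.mulVecLin, Q.mulVecLin v ∈ LinearMap.ker B.mulVecLin := by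
    intro v hv
    rw [LinearMap.mem_ker, Matrix.mulVecLin_apply] at hv ⊢
    rw [Matrix.mulVecLin_apply]
    have : (Q * A).mulVec v = 0 := by rw [← Matrix.mulVec_mulVec, hv, Matrix.mulVec_zero]
    rw [h3, ← Matrix.mul_assoc, ← Matrix.mul_assoc, h2, Matrix.one_mul] at this
    rw [Matrix.mulVec_mulVec, this]
  refine LinearMap.finrank_le_finrank_of_injective (f := Q.mulVecLin.restrict hm) ?_
  intro v w hvw
  have hvw' : Q.mulVec v.1 = Q.mulVec w.1 := congrArg Subtype.val hvw
  apply Subtype.ext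
  have := congrArg P.mulVec hvw'
  simpa [Matrix.mulVec_mulVec, h1] using this

theorem MatrixSimilar.nullity_eq {ι κ : Type*} [Fintype ι] [DecidableEq ι] [Fintype κ] [DecidableEq κ]
    {A : Matrix ι ι F} {B : Matrix κ κ F} (h : MatrixSimilar A B) : nullity A = nullity B :=
  le_antisymm h.nullity_le h.symm.nullity_le

theorem blockDiagonal'_mulVec {ι : Type*} [Fintype ι] [DecidableEq ι] {d : ι → Type*}
    [∀ i, Fintype (d i)] [∀ i, DecidableEq (d i)] (M : ∀ i, Matrix (d i) (d i) F)
    (v : (Σ i, d i) → F) (i : ι) (x : d i) :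
    (Matrix.blockDiagonal' M).mulVec v ⟨i, x⟩ = (M i).mulVec (fun y => v ⟨i, y⟩) x := by
  simp only [Matrix.mulVec, dotProduct]
  rw [Fintype.sum_sigma, Finset.sum_eq_single i]
  · simp
  · intro j _ hj
    refine Finset.sum_eq_zero fun y _ => ?_
    rw [Matrix.blockDiagonal'_apply_ne _ _ _ hj.symm, zero_mul]
  · simp

theorem nullity_blockDiagonal' {ι : Type*} [Fintype ι] [DecidableEq ι] {d : ι → Type*}
    [∀ i, Fintype (d i)] [∀ i, DecidableEq (d i)] (M : ∀ i, Matrix (d i) (d i) F) :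
    nullity (Matrix.blockDiagonal' M) = ∑ i, nullity (M i) := by
  unfold nullity
  rw [← Module.finrank_pi_fintype]
  refine LinearEquiv.finrank_eq
    { toFun := fun v i => ⟨fun x => v.1 ⟨i, x⟩, ?_⟩
      invFun := fun w => ⟨fun x => (w x.1).1 x.2, ?_⟩
      map_add' := fun _ _ => rfl
      map_smul' := fun _ _ => rfl
      left_inv := fun _ => rfl
      right_inv := fun _ => rfl }
  · have := v.2
    rw [LinearMap.mem_ker, Matrix.mulVecLin_apply] at this ⊢
    funext x
    rw [← blockDiagonal'_mulVec, this]; rfl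
  · rw [LinearMap.mem_ker, Matrix.mulVecLin_apply]
    funext ⟨i, x⟩
    rw [blockDiagonal'_mulVec]
    have := (w i).2
    rw [LinearMap.mem_ker, Matrix.mulVecLin_apply] at this
    exact congrFun this x

theorem aeval_blockDiagonal' {ι : Type*} [Fintype ι] [DecidableEq ι] {d : ι → Type*}
    [∀ i, Fintype (d i)] [∀ i, DecidableEq (d i)] (M : ∀ i, Matrix (d i) (d i) F) (y : F[X]) :
    aeval (Matrix.blockDiagonal' M) y = Matrix.blockDiagonal' fun i => aeval (M i) y := by
  induction y using Polynomial.induction_on with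
  | C a =>
    simp only [aeval_C, Algebra.algebraMap_eq_smul_one]
    rw [← Matrix.blockDiagonal'_one, ← Matrix.blockDiagonal'_smul]; rfl
  | add f g hf hg => simp only [map_add, hf, hg]; rw [← Matrix.blockDiagonal'_add]; rfl
  | monomial n a h =>
    rw [aeval_C_mul_X_pow_succ, h, ← Matrix.blockDiagonal'_mul]
    congr 1
    funext i
    rw [aeval_C_mul_X_pow_succ]

theorem nullity_aeval_companion {q : F[X]} (hq : q.Monic) (y : F[X]) :
    nullity (aeval (companion q) y) =
      Module.finrank F (F[X] ⧸ (Ideal.span {q} ⊔ Ideal.span {y} : Ideal F[X])) := by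
  let b : Module.Basis (Fin q.natDegree) F (AdjoinRoot q) := (AdjoinRoot.powerBasis' hq).basis
  have : FiniteDimensional F (AdjoinRoot q) := b.finiteDimensional_of_finite
  have h0 : companion q = Algebra.leftMulMatrix b (AdjoinRoot.root q) :=
    (companion_eq_leftMulMatrix hq).symm
  have h1 : aeval (companion q) y = Algebra.leftMulMatrix b (AdjoinRoot.mk q y) := by
    rw [h0, ← AdjoinRoot.aeval_eq, aeval_algHom_apply]
  let T := LinearMap.mulLeft F (AdjoinRoot.mk q y)
  have hT : (Algebra.leftMulMatrix b (AdjoinRoot.mk q y)).rank =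
      Module.finrank F (LinearMap.range T) := by
    rw [Matrix.rank_eq_finrank_range_toLin _ b b, Algebra.leftMulMatrix_apply,
      Matrix.toLin_toMatrix]
    rfl
  have e1 := LinearMap.finrank_range_add_finrank_ker (aeval (companion q) y).mulVecLin
  have e2 := Submodule.finrank_quotient_add_finrank (LinearMap.range T)
  have e3 : Module.finrank F (AdjoinRoot q) = q.natDegree := by
    rw [Module.finrank_eq_card_basis b, Fintype.card_fin]
  have e4 : Module.finrank F (Fin q.natDegree → F) = q.natDegree := by simp
  rw [e4] at e1
  rw [e3] at e2
  have e5 : Module.finrank F (LinearMap.range (aeval (companion q) y).mulVecLin) =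
      Module.finrank F (LinearMap.range T) := by rw [← hT, ← h1]; rfl
  have e6 : Module.finrank F (AdjoinRoot q ⧸ LinearMap.range T) =
      Module.finrank F (F[X] ⧸ (Ideal.span {q} ⊔ Ideal.span {y} : Ideal F[X])) := by
    have a1 := (DoubleQuot.quotQuotEquivQuotSupₐ F (Ideal.span {q}) (Ideal.span {y})).toLinearEquiv
    rw [← a1.finrank_eq]
    have : LinearMap.range T = ((Ideal.span {y}).map
        (Ideal.Quotient.mkₐ F (Ideal.span {q}))).restrictScalars F := by
      ext z
      change _ ↔ z ∈ (Ideal.span {y}).map (Ideal.Quotient.mkₐ F (Ideal.span {q}))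
      rw [Ideal.map_span, Set.image_singleton]
      refine Iff.trans ?_ (Ideal.mem_span_singleton (α := F[X] ⧸ Ideal.span {q})).symm
      exact ⟨fun ⟨w, hw⟩ => ⟨w, hw.symm⟩, fun ⟨w, hw⟩ => ⟨w, hw.symm⟩⟩
    rw [this]
    rfl
  unfold nullity
  omega

/-- The elementary divisors are unique. -/
theorem IsElementaryDivisors.unique {n : ℕ} {A : Matrix (Fin n) (Fin n) F} {s t : Multiset F[X]}
    (hs : IsElementaryDivisors A s) (ht : IsElementaryDivisors A t) : s = t := by
  classical
  let N : F[X] → F[X] → ℕ := fun y q =>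
    Module.finrank F (F[X] ⧸ (Ideal.span {q} ⊔ Ideal.span {y} : Ideal F[X]))
  have key : ∀ s, IsElementaryDivisors A s → ∀ y, nullity (aeval A y) = (s.map (N y)).sum := by
    rintro s ⟨m, q, rfl, hq, hA⟩ y
    rw [(hA.aeval y).nullity_eq, aeval_blockDiagonal', nullity_blockDiagonal', Multiset.map_map]
    refine Finset.sum_congr rfl fun i _ => ?_
    obtain ⟨p, e, hp, _, _, h⟩ := hq i
    exact nullity_aeval_companion (by rw [h]; exact hp.pow e) y
  have prim : ∀ s, IsElementaryDivisors A s → ∀ q ∈ s,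
      ∃ (p : F[X]) (e : ℕ), p.Monic ∧ Irreducible p ∧ 0 < e ∧ q = p ^ e := by
    rintro s ⟨m, q, rfl, hq, -⟩ z hz
    obtain ⟨i, -, rfl⟩ := Multiset.mem_map.1 hz
    exact hq i
  have same : ∀ (p : F[X]) (i j : ℕ), N (p ^ i) (p ^ j) = min i j * p.natDegree := by
    intro p i j
    have : (Ideal.span {p ^ j} ⊔ Ideal.span {p ^ i} : Ideal F[X]) =
        Ideal.span {p ^ min i j} := by
      rcases le_total i j with h | h
      · rw [min_eq_left h, sup_eq_right]
        exact Ideal.span_singleton_le_span_singleton.2 (pow_dvd_pow _ h)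
      · rw [min_eq_right h, sup_eq_left]
        exact Ideal.span_singleton_le_span_singleton.2 (pow_dvd_pow _ h)
    simp only [N]
    rw [this, finrank_quotient_span_eq_natDegree, natDegree_pow]
  have diff : ∀ (p q : F[X]) (i j : ℕ), p.Monic → Irreducible p → q.Monic → Irreducible q →
      p ≠ q → N (p ^ i) (q ^ j) = 0 := by
    intro p q i j hp hp' hq hq' hpq
    have hc : IsCoprime q p := by
      refine (hq'.coprime_iff_not_dvd).2 fun h => hpq ?_
      exact (eq_of_monic_of_associated hq hp (hq'.associated_of_dvd hp' h)).symm
    have : (Ideal.span {q ^ j} ⊔ Ideal.span {p ^ i} : Ideal F[X]) = ⊤ :=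
      Ideal.isCoprime_iff_sup_eq.1 ((Ideal.isCoprime_span_singleton_iff _ _).2 hc.pow)
    simp only [N]
    rw [this]
    have : Subsingleton (F[X] ⧸ (⊤ : Ideal F[X])) := Ideal.Quotient.subsingleton_iff.2 rfl
    exact Module.finrank_zero_of_subsingleton
  have cnt : ∀ s, IsElementaryDivisors A s → ∀ (p : F[X]) (k : ℕ), p.Monic → Irreducible p →
      nullity (aeval A (p ^ k)) + nullity (aeval A (p ^ (k + 2))) + s.count (p ^ (k + 1)) * p.natDegree
        = 2 * nullity (aeval A (p ^ (k + 1))) := by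
    intro s hs p k hp hp'
    rw [key s hs, key s hs, key s hs]
    have hprim := prim s hs
    clear hs
    induction s using Multiset.induction_on with
    | empty => simp
    | cons a s ih =>
      have ih' := ih fun q hq => hprim q (Multiset.mem_cons_of_mem hq)
      have ha : N (p ^ k) a + N (p ^ (k + 2)) a + (if p ^ (k + 1) = a then 1 else 0) * p.natDegree
          = 2 * N (p ^ (k + 1)) a := by
        obtain ⟨r, e, hr, hr', he, rfl⟩ := hprim a (Multiset.mem_cons_self _ _)
        by_cases hpr : p = r
        · subst hpr
          rw [same, same, same]
          have hiff : p ^ (k + 1) = p ^ e ↔ k + 1 = e := by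
            constructor
            · intro h
              have := congrArg natDegree h
              rw [natDegree_pow, natDegree_pow] at this
              exact Nat.eq_of_mul_eq_mul_right hp'.natDegree_pos this
            · rintro rfl; rfl
          rw [← add_mul, ← add_mul, ← mul_assoc]
          congr 1
          simp only [hiff]
          split_ifs <;> omega
        · have hne : p ^ (k + 1) ≠ r ^ e := by
            intro h
            have : p ∣ r := hp'.prime.dvd_of_dvd_pow (h ▸ dvd_pow_self p (Nat.succ_ne_zero k))
            exact hpr (eq_of_monic_of_associated hp hr (hp'.associated_of_dvd hr' this))
          rw [diff _ _ _ _ hp hp' hr hr' hpr, diff _ _ _ _ hp hp' hr hr' hpr,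
            diff _ _ _ _ hp hp' hr hr' hpr, if_neg hne]
          simp
      rw [Multiset.count_cons, add_mul]
      simp only [Multiset.map_cons, Multiset.sum_cons]
      omega
  have le : ∀ s t, IsElementaryDivisors A s → IsElementaryDivisors A t → s ≤ t := by
    intro s t hs ht
    refine Multiset.le_iff_count.2 fun q => ?_
    by_cases hq : q ∈ s
    · obtain ⟨p, e, hp, hp', he, rfl⟩ := prim s hs q hq
      obtain ⟨k, rfl⟩ : ∃ k, e = k + 1 := ⟨e - 1, by omega⟩
      have h1 := cnt s hs p k hp hp'
      have h2 := cnt t ht p k hp hp'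
      exact (Nat.eq_of_mul_eq_mul_right hp'.natDegree_pos (by omega)).le
    · rw [Multiset.count_eq_zero_of_notMem hq]; exact Nat.zero_le _
  exact le_antisymm (le s t hs ht) (le t s ht hs)

/-- The multiset of all elementary divisors of `A`, each with its multiplicity. -/
noncomputable def elementaryDivisors {n : ℕ} (A : Matrix (Fin n) (Fin n) F) : Multiset F[X] :=
  Classical.choose (exists_isElementaryDivisors A)

theorem isElementaryDivisors_iff {n : ℕ} (A : Matrix (Fin n) (Fin n) F) (s : Multiset F[X]) :
    IsElementaryDivisors A s ↔ s = elementaryDivisors A :=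
  ⟨fun h => h.unique (Classical.choose_spec (exists_isElementaryDivisors A)),
    fun h => h ▸ Classical.choose_spec (exists_isElementaryDivisors A)⟩

/-- A cyclic matrix is one that is similar to a companion matrix. -/
def IsCyclicMatrix {n : ℕ} (A : Matrix (Fin n) (Fin n) F) : Prop :=
  ∃ f : F[X], f.Monic ∧ f.natDegree = n ∧ MatrixSimilar A (companion f)

/-- `A` is of polynomial type: it is equal to a polynomial in a cyclic matrix. -/
def IsPolynomialType {n : ℕ} (A : Matrix (Fin n) (Fin n) F) : Prop :=
  ∃ (B : Matrix (Fin n) (Fin n) F) (g : F[X]), IsCyclicMatrix B ∧ A = aeval B g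

end Matrices

section Omega

variable {F : Type u} [Field F]

/-- The group `Ω` of all invertible matrices `!![a, b; 0, 1]`. -/
def Omega (F : Type u) [Field F] : Subgroup (GL (Fin 2) F) where
  carrier := {M | (M : Matrix (Fin 2) (Fin 2) F) 1 0 = 0 ∧ (M : Matrix (Fin 2) (Fin 2) F) 1 1 = 1}
  one_mem' := by simp
  mul_mem' := by
    rintro M N ⟨h1, h2⟩ ⟨h3, h4⟩
    simp [Matrix.mul_apply, h1, h2, h3, h4]
  inv_mem' := by
    rintro M ⟨h1, h2⟩
    have h : ((M⁻¹ : GL (Fin 2) F) : Matrix (Fin 2) (Fin 2) F) * M = 1 := by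
      rw [← Units.val_mul, inv_mul_cancel]; rfl
    have e0 := congrFun (congrFun h 1) 0
    have e1 := congrFun (congrFun h 1) 1
    have hd : (M : Matrix (Fin 2) (Fin 2) F) 0 0 ≠ 0 := by
      intro h0
      have := congrFun (congrFun h 0) 0
      simp [Matrix.mul_apply, Fin.sum_univ_two, h1, h0] at this
    simp only [Matrix.mul_apply, Fin.sum_univ_two, h1, h2, mul_zero, add_zero, mul_one] at e0 e1
    have e0' : ((M⁻¹ : GL (Fin 2) F) : Matrix (Fin 2) (Fin 2) F) 1 0 = 0 := by
      simpa [hd] using e0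
    refine ⟨e0', ?_⟩
    simpa [e0'] using e1

/-- The matrix `!![a, b; 0, 1]` as an element of `Ω`. -/
def Omega.mk (a : Fˣ) (b : F) : Omega F :=
  ⟨⟨!![(a : F), b; 0, 1], !![((a⁻¹ : Fˣ) : F), -((a⁻¹ : Fˣ) : F) * b; 0, 1],
      by ext i j; fin_cases i <;> fin_cases j <;> simp,
      by ext i j; fin_cases i <;> fin_cases j <;> simp⟩,
    by simp [Omega]⟩

/-- `f^M = a^{-deg f} f(aX + b)` for `M = !![a, b; 0, 1]`. -/
noncomputable def omegaConj (f : F[X]) (M : Omega F) : F[X] :=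
  let a := (M : GL (Fin 2) F).val 0 0
  let b := (M : GL (Fin 2) F).val 0 1
  C (a⁻¹ ^ f.natDegree) * f.comp (C a * X + C b)

/-- The stabilizer `S_f` of `f` in the additive group of `F`, where `b : F` acts as
`!![1, b; 0, 1]`. -/
def addStabilizer (f : F[X]) : Set F := {b | omegaConj f (Omega.mk 1 b) = f}

/-- The stabilizer `T_f` of `f` in the multiplicative group of `F`, where `a : Fˣ` acts as
`!![a, 0; 0, 1]`. -/
def mulStabilizer (f : F[X]) : Set Fˣ := {a | omegaConj f (Omega.mk a 0) = f}

open Classical in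
/-- `ℓ(p)`: the number of elementary divisors of `A`, counted with multiplicity, that are a power of
an `Ω`-conjugate of `p`. -/
noncomputable def ell {n : ℕ} (A : Matrix (Fin n) (Fin n) F) (p : F[X]) : ℕ :=
  (elementaryDivisors A).countP fun q => ∃ (M : Omega F) (k : ℕ), q = omegaConj p M ^ k

end Omega

end PolynomialType

open PolynomialType

/-! Write `A` as similar to the direct sum of the companion matrices of `q_i = p_i ^ e_i`. If `r_i =
p_i^M` with parameters `a_i`, `b_i`, then `X ↦ a_i⁻¹(X - b_i)` induces an isomorphism `F[X]/(r_i ^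
e_i) ≅ F[X]/(q_i)` carrying multiplication by `a_i X + b_i` to multiplication by `X`. If the `r_i`
are distinct, the `r_i ^ e_i` are pairwise coprime, and the Chinese remainder theorem gives one `g`
congruent to every `a_i X + b_i` modulo `r_i ^ e_i`. With `f = ∏ r_i ^ e_i`, multiplication by `g`
on `F[X]/(f)` is then the direct sum of the multiplications by `X` on the `F[X]/(q_i)`; that is,
`g(C_f)` is similar to `A` (`exists_aeval_companion_similar`).

It remains to choose distinct conjugates. Orbits are equal or disjoint, so it is enough that the
orbit of `p` has at least `ℓ(p)` elements (`card_le_encard_omegaOrbit`). Over an infinite field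
every orbit of a nonconstant polynomial is infinite. Over a finite field either `S_p = 0`, and the
translates are distinct, or `S_p ≠ 0`, which forces `T_p = 1` because the Galois group of `F[X]/(p)`
is abelian, and then the scalings are distinct. -/

namespace PolynomialType

universe u

/-! ### The action of `Ω`, sizes of orbits, and distinct representatives -/

section Orbits

variable {F : Type u} [Field F]

theorem omegaConj_mk (f : F[X]) (a : Fˣ) (b : F) :
    omegaConj f (Omega.mk a b) =
      C ((a : F)⁻¹ ^ f.natDegree) * f.comp (C (a : F) * X + C b) := by
  simp [omegaConj, Omega.mk]

theorem exists_omega_eq_mk (M : Omega F) : ∃ (a : Fˣ) (b : F), M = Omega.mk a b := by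
  obtain ⟨M, h1, h2⟩ := M
  have hd : M.val 0 0 ≠ 0 := by
    intro h0
    have h : (M : Matrix (Fin 2) (Fin 2) F) * (M⁻¹ : GL (Fin 2) F) = 1 := by
      rw [← Units.val_mul, mul_inv_cancel]; rfl
    have h' := congrArg Matrix.det h
    rw [Matrix.det_mul, Matrix.det_fin_two M.val, h0, h1] at h'
    simp at h'
  refine ⟨Units.mk0 _ hd, M.val 0 1, Subtype.ext (Units.ext ?_)⟩
  ext i j
  fin_cases i <;> fin_cases j <;> simp [Omega.mk, h1, h2]

/-- The set of `Ω`-conjugates of a polynomial. -/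
def omegaOrbit (f : F[X]) : Set F[X] := {g | ∃ M : Omega F, g = omegaConj f M}

theorem mem_omegaOrbit {f g : F[X]} :
    g ∈ omegaOrbit f ↔ ∃ (a : Fˣ) (b : F), g = omegaConj f (Omega.mk a b) := by
  constructor
  · rintro ⟨M, rfl⟩
    obtain ⟨a, b, rfl⟩ := exists_omega_eq_mk M
    exact ⟨a, b, rfl⟩
  · rintro ⟨a, b, rfl⟩
    exact ⟨_, rfl⟩

theorem natDegree_omegaConj (f : F[X]) (a : Fˣ) (b : F) :
    (omegaConj f (Omega.mk a b)).natDegree = f.natDegree := by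
  rw [omegaConj_mk, natDegree_C_mul (by simp), natDegree_comp, natDegree_linear a.ne_zero, mul_one]

/-- The resulting parameters are those of the matrix product in the same order: `Ω` acts on the
right. -/
theorem omegaConj_omegaConj (f : F[X]) (a c : Fˣ) (b d : F) :
    omegaConj (omegaConj f (Omega.mk a b)) (Omega.mk c d) =
      omegaConj f (Omega.mk (a * c) (a * d + b)) := by
  rw [omegaConj_mk _ c, natDegree_omegaConj, omegaConj_mk, omegaConj_mk]
  simp only [mul_comp, C_comp, comp_assoc, add_comp, X_comp, Units.val_mul, mul_inv, mul_pow,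
    C_mul, C_add]
  ring_nf

theorem omegaConj_one_zero (f : F[X]) : omegaConj f (Omega.mk 1 0) = f := by
  simp [omegaConj_mk]

theorem omegaOrbit_eq_of_mem {f g : F[X]} (h : g ∈ omegaOrbit f) :
    omegaOrbit g = omegaOrbit f := by
  have sub : ∀ {f g : F[X]}, g ∈ omegaOrbit f → omegaOrbit g ⊆ omegaOrbit f := by
    intro f g h k hk
    obtain ⟨a, b, rfl⟩ := mem_omegaOrbit.1 h
    obtain ⟨c, d, rfl⟩ := mem_omegaOrbit.1 hk
    exact mem_omegaOrbit.2 ⟨_, _, omegaConj_omegaConj _ _ _ _ _⟩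
  refine (sub h).antisymm (sub ?_)
  obtain ⟨a, b, rfl⟩ := mem_omegaOrbit.1 h
  -- These are the entries of the inverse matrix.
  refine mem_omegaOrbit.2 ⟨a⁻¹, -((a⁻¹ : Fˣ) : F) * b, ?_⟩
  rw [omegaConj_omegaConj]
  simp [omegaConj_one_zero]

theorem monic_omegaConj {f : F[X]} (hf : f.Monic) (a : Fˣ) (b : F) :
    (omegaConj f (Omega.mk a b)).Monic := by
  rw [omegaConj_mk, Monic, leadingCoeff_mul, leadingCoeff_C, leadingCoeff_comp
    (by rw [natDegree_linear a.ne_zero]; exact one_ne_zero), leadingCoeff_linear a.ne_zero,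
    hf.leadingCoeff, one_mul, ← mul_pow]
  simp

/-- Substituting `aX + b` is an automorphism of `F[X]`, and the normalizing scalar is a unit. -/
theorem irreducible_omegaConj {f : F[X]} (hf : Irreducible f) (a : Fˣ) (b : F) :
    Irreducible (omegaConj f (Omega.mk a b)) := by
  rw [omegaConj_mk]
  have hu : IsUnit (C ((a : F)⁻¹ ^ f.natDegree)) :=
    isUnit_C.2 ((IsUnit.mk0 _ (inv_ne_zero a.ne_zero)).pow _)
  rw [irreducible_isUnit_mul hu]
  have hinv : Invertible (a : F) := a.invertible
  have := (MulEquiv.irreducible_iff (algEquivCMulXAddC (a : F) b)).2 hf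
  simpa [comp, aeval_def] using this

/-- With a trivial stabilizer, `b ↦ p(X + b)` is injective: if two translates agree, the difference
of their parameters fixes `p`. -/
theorem card_le_encard_omegaOrbit_of_addStabilizer_eq_zero {p : F[X]} (h : addStabilizer p = {0}) :
    ENat.card F ≤ (omegaOrbit p).encard := by
  rw [← Set.encard_univ]
  refine Set.encard_le_encard_of_injOn (f := fun b => omegaConj p (Omega.mk 1 b))
    (fun b _ => ⟨_, rfl⟩) fun b _ c _ hbc => ?_
  have h1 := congrArg (fun q => omegaConj q (Omega.mk 1 (-c))) hbc
  simp only [omegaConj_omegaConj] at h1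
  have h2 : b - c ∈ addStabilizer p := by
    simpa [addStabilizer, omegaConj_one_zero, sub_eq_add_neg, add_comm] using h1
  rw [h] at h2
  exact sub_eq_zero.1 h2

theorem card_units_le_encard_omegaOrbit_of_mulStabilizer_eq_one {p : F[X]} (h : mulStabilizer p = {1}) :
    ENat.card Fˣ ≤ (omegaOrbit p).encard := by
  rw [← Set.encard_univ]
  refine Set.encard_le_encard_of_injOn (f := fun a => omegaConj p (Omega.mk a 0))
    (fun b _ => ⟨_, rfl⟩) fun b _ c _ hbc => ?_
  have h1 := congrArg (fun q => omegaConj q (Omega.mk c⁻¹ 0)) hbc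
  simp only [omegaConj_omegaConj] at h1
  have h2 : b * c⁻¹ ∈ mulStabilizer p := by
    simpa [mulStabilizer, omegaConj_one_zero] using h1
  rw [h] at h2
  exact mul_inv_eq_one.1 h2

/-- The constant coefficient of `p(X + b)` is `p(b)`, and a nonconstant polynomial on an infinite
field takes infinitely many values, since it takes each value only finitely often. -/
theorem infinite_omegaOrbit [Infinite F] {p : F[X]} (hp : p.natDegree ≠ 0) :
    (omegaOrbit p).Infinite := by
  intro hfin
  have h1 : (Set.range fun b => p.eval b).Finite := by
    refine (hfin.image fun q => q.coeff 0).subset ?_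
    rintro _ ⟨b, rfl⟩
    refine ⟨_, ⟨Omega.mk 1 b, rfl⟩, ?_⟩
    simp [omegaConj_mk, coeff_zero_eq_eval_zero, eval_comp]
  have : Finite (Set.range fun b => p.eval b) := h1
  obtain ⟨⟨c, hc⟩, hinf⟩ := Finite.exists_infinite_fiber (Set.rangeFactorization fun b => p.eval b)
  have hz : p - C c = 0 := by
    refine eq_zero_of_infinite_isRoot _ ((Set.infinite_coe_iff.1 hinf).mono ?_)
    intro b hb
    have : p.eval b = c := congrArg Subtype.val hb
    simp [this]
  rw [sub_eq_zero.1 hz] at hp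
  simp at hp

/-- Over a finite field the `F`-endomorphisms of `F[X]/(p)` commute, but `X ↦ X + b` and
`X ↦ aX` do not. -/
theorem mulStabilizer_eq_of_addStabilizer_ne [Finite F] {p : F[X]} (hp : Irreducible p)
    (h : addStabilizer p ≠ {0}) : mulStabilizer p = {1} := by
  have : Fact (Irreducible p) := ⟨hp⟩
  have : FiniteDimensional F (AdjoinRoot p) := (AdjoinRoot.powerBasis hp.ne_zero).finite
  have : Finite (AdjoinRoot p) := Module.finite_of_finite F
  have hcomm : ∀ σ τ : AdjoinRoot p →ₐ[F] AdjoinRoot p, ∀ x, σ (τ x) = τ (σ x) := by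
    intro σ τ x
    -- Every automorphism is a power of the Frobenius.
    have hc : ∀ s t : AdjoinRoot p ≃ₐ[F] AdjoinRoot p, s * t = t * s := by
      have : Fintype F := Fintype.ofFinite F
      intro s t
      obtain ⟨i, rfl⟩ := (FiniteField.bijective_frobeniusAlgEquivOfAlgebraic_pow F _).2 s
      obtain ⟨j, rfl⟩ := (FiniteField.bijective_frobeniusAlgEquivOfAlgebraic_pow F _).2 t
      exact (Commute.refl _).pow_pow _ _
    exact AlgEquiv.congr_fun (hc
      (AlgEquiv.ofBijective σ (Algebra.IsAlgebraic.algHom_bijective σ))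
      (AlgEquiv.ofBijective τ (Algebra.IsAlgebraic.algHom_bijective τ))) x
  -- If `p` is fixed, then `ax + b` is a root of `p` whenever `x` is, so `x ↦ ax + b` extends to an
  -- endomorphism.
  have hhom : ∀ (a : Fˣ) (b : F), omegaConj p (Omega.mk a b) = p →
      ∃ σ : AdjoinRoot p →ₐ[F] AdjoinRoot p, σ (AdjoinRoot.root p) =
        algebraMap F _ a * AdjoinRoot.root p + algebraMap F _ b := by
    intro a b hab
    refine ⟨AdjoinRoot.liftAlgHom p (Algebra.ofId _ _)
      (algebraMap F _ a * AdjoinRoot.root p + algebraMap F _ b) ?_, AdjoinRoot.liftAlgHom_root _ _ _ _⟩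
    have h1 : aeval (AdjoinRoot.root p) (omegaConj p (Omega.mk a b)) = 0 := by
      rw [hab, AdjoinRoot.aeval_eq, AdjoinRoot.mk_self]
    rw [omegaConj_mk, map_mul, aeval_C, aeval_comp] at h1
    have h2 := (mul_eq_zero.1 h1).resolve_left (by simp)
    simpa [aeval_def] using h2
  have h0 : (0 : F) ∈ addStabilizer p := omegaConj_one_zero p
  obtain ⟨b, hb, hb0⟩ : ∃ b ∈ addStabilizer p, b ≠ 0 := by
    by_contra! hcon
    exact h (Set.eq_singleton_iff_unique_mem.2 ⟨h0, hcon⟩)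
  obtain ⟨σ, hσ⟩ := hhom 1 b hb
  refine Set.eq_singleton_iff_unique_mem.2 ⟨omegaConj_one_zero p, fun a ha => ?_⟩
  obtain ⟨τ, hτ⟩ := hhom a 0 ha
  -- At the root `x` the two composites are `ax + ab` and `ax + b`; hence `ab = b` with `b ≠ 0`.
  have h1 := hcomm σ τ (AdjoinRoot.root p)
  rw [hσ, hτ] at h1
  simp only [map_add, map_mul, AlgHom.commutes, hσ, hτ, Units.val_one, map_one, one_mul, map_zero,
    add_zero, mul_add, add_right_inj] at h1
  rw [← map_mul] at h1
  have h2 := (algebraMap F (AdjoinRoot p)).injective h1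
  exact Units.ext (mul_right_cancel₀ hb0 (h2.trans (one_mul b).symm))

/-- For sets that are pairwise equal or disjoint, Hall's condition reduces to one count per set: the
indices sharing a set are injected into it, and the injections for different sets cannot collide. -/
theorem exists_injective_mem_of_encard_le {ι α : Type*} [Finite ι] [Nonempty α] (O : ι → Set α)
    (hO : ∀ i j x, x ∈ O i → x ∈ O j → O i = O j)
    (hcard : ∀ i, {j | O j = O i}.encard ≤ (O i).encard) :
    ∃ r : ι → α, Function.Injective r ∧ ∀ i, r i ∈ O i := by
  have h : ∀ c : Set α, ∃ φ : ι → α, (∀ j, O j = c → φ j ∈ c) ∧ Set.InjOn φ {j | O j = c} := by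
    intro c
    by_cases hc : ∃ i, O i = c
    · obtain ⟨i, rfl⟩ := hc
      obtain ⟨φ, h1, h2⟩ := (Set.toFinite {j | O j = O i}).exists_injOn_of_encard_le (hcard i)
      exact ⟨φ, fun j hj => h1 hj, h2⟩
    -- No index has the set `c`, so any function will do.
    · refine ⟨fun _ => Classical.arbitrary α, fun j hj => (hc ⟨j, hj⟩).elim, fun j hj => ?_⟩
      exact (hc ⟨j, hj⟩).elim
  choose φ h1 h2 using h
  refine ⟨fun i => φ (O i) i, fun i j hij => ?_, fun i => h1 _ i rfl⟩
  have hO' : O i = O j := hO i j (φ (O i) i) (h1 _ i rfl) (by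
    simp only at hij; rw [hij]; exact h1 _ j rfl)
  refine h2 (O i) rfl hO'.symm ?_
  simp only at hij
  rw [hij, hO']

end Orbits

/-! ### Polynomials in companion matrices and the Chinese remainder theorem -/

section LinearAlgebra

variable {F : Type u} [Field F]

theorem MatrixSimilar.trans {ι κ μ : Type*} [Fintype ι] [DecidableEq ι] [Fintype κ]
    [DecidableEq κ] [Fintype μ] [DecidableEq μ] {A : Matrix ι ι F} {B : Matrix κ κ F}
    {D : Matrix μ μ F} (h : MatrixSimilar A B) (h' : MatrixSimilar B D) : MatrixSimilar A D := by
  obtain ⟨P, Q, h1, h2, h3⟩ := h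
  obtain ⟨P', Q', h1', h2', h3'⟩ := h'
  refine ⟨P * P', Q' * Q, ?_, ?_, ?_⟩
  · rw [Matrix.mul_assoc, ← Matrix.mul_assoc P', h1', Matrix.one_mul, h1]
  · rw [Matrix.mul_assoc, ← Matrix.mul_assoc Q, h2, Matrix.one_mul, h2']
  · rw [h3, h3']
    simp only [Matrix.mul_assoc]

theorem aeval_conj {ι κ : Type*} [Fintype ι] [DecidableEq ι] [Fintype κ] [DecidableEq κ]
    {P : Matrix ι κ F} {Q : Matrix κ ι F} (h1 : P * Q = 1) (h2 : Q * P = 1) (B : Matrix κ κ F)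
    (g : F[X]) : aeval (P * B * Q) g = P * aeval B g * Q := by
  induction g using Polynomial.induction_on with
  | C a =>
    rw [aeval_C, aeval_C, Algebra.algebraMap_eq_smul_one, Algebra.algebraMap_eq_smul_one]
    simp [h1]
  | add f g hf hg => rw [map_add, map_add, hf, hg, Matrix.mul_add, Matrix.add_mul]
  | monomial n a h =>
    rw [aeval_C_mul_X_pow_succ, aeval_C_mul_X_pow_succ, h]
    simp only [Matrix.mul_assoc]
    rw [← Matrix.mul_assoc Q P, h2, Matrix.one_mul]

theorem aeval_companion {f : F[X]} (hf : f.Monic) (g : F[X]) :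
    aeval (companion f) g =
      Algebra.leftMulMatrix (AdjoinRoot.powerBasis' hf).basis (AdjoinRoot.mk f g) := by
  let b : Module.Basis (Fin f.natDegree) F (AdjoinRoot f) := (AdjoinRoot.powerBasis' hf).basis
  have h : companion f = Algebra.leftMulMatrix b (AdjoinRoot.root f) :=
    (companion_eq_leftMulMatrix hf).symm
  change _ = Algebra.leftMulMatrix b (AdjoinRoot.mk f g)
  rw [h, ← AdjoinRoot.aeval_eq, aeval_algHom_apply]

theorem aeval_companion_eq_zero_iff {f : F[X]} (hf : f.Monic) (g : F[X]) :
    aeval (companion f) g = 0 ↔ f ∣ g := by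
  rw [aeval_companion hf, ← AdjoinRoot.mk_eq_zero]
  exact map_eq_zero_iff _ (Algebra.leftMulMatrix_injective _)

/-- The minimal polynomial of `A` annihilates each diagonal block, and the polynomials annihilating
`companion (q i)` are the multiples of `q i`. -/
theorem dvd_minpoly_of_similar {n : ℕ} {A : Matrix (Fin n) (Fin n) F} {ι : Type*} [Fintype ι]
    [DecidableEq ι] {q : ι → F[X]} (hq : ∀ i, (q i).Monic)
    (h : MatrixSimilar A (Matrix.blockDiagonal' fun i => companion (q i))) (i : ι) :
    q i ∣ minpoly F A := by
  obtain ⟨P, Q, -, -, h3⟩ := h.symm.aeval (minpoly F A)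
  rw [minpoly.aeval, Matrix.mul_zero, Matrix.zero_mul, aeval_blockDiagonal'] at h3
  rw [← aeval_companion_eq_zero_iff (hq i)]
  ext x y
  have := congrFun (congrFun h3 ⟨i, x⟩) ⟨i, y⟩
  rwa [Matrix.blockDiagonal'_apply_eq] at this

theorem omegaConj_pow (p : F[X]) (e : ℕ) (a : Fˣ) (b : F) :
    omegaConj p (Omega.mk a b) ^ e = omegaConj (p ^ e) (Omega.mk a b) := by
  simp only [omegaConj_mk, natDegree_pow, mul_pow, pow_comp, ← C_pow, ← pow_mul, mul_comm]

/-- Up to a unit, the conjugate is the image of `q` under the automorphism `X ↦ aX + b`; the right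
side applies the inverse automorphism `X ↦ a⁻¹(X - b)`. -/
theorem omegaConj_dvd_iff {q : F[X]} (h : F[X]) (a : Fˣ) (b : F) :
    omegaConj q (Omega.mk a b) ∣ h ↔
      q ∣ h.comp (C ((a⁻¹ : Fˣ) : F) * X - C (((a⁻¹ : Fˣ) : F) * b)) := by
  have hu : IsUnit (C ((a : F)⁻¹ ^ q.natDegree)) :=
    isUnit_C.2 ((IsUnit.mk0 _ (inv_ne_zero a.ne_zero)).pow _)
  have c1 : (C (a : F) * X + C b : F[X]).comp
      (C ((a⁻¹ : Fˣ) : F) * X - C (((a⁻¹ : Fˣ) : F) * b)) = X := by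
    simp only [add_comp, mul_comp, C_comp, X_comp, mul_sub, ← mul_assoc, ← C_mul, Units.mul_inv]
    simp
  have c2 : (C ((a⁻¹ : Fˣ) : F) * X - C (((a⁻¹ : Fˣ) : F) * b) : F[X]).comp
      (C (a : F) * X + C b) = X := by
    simp only [sub_comp, mul_comp, C_comp, X_comp, mul_add, ← mul_assoc, ← C_mul, Units.inv_mul]
    simp
  rw [omegaConj_mk, hu.mul_left_dvd]
  constructor
  · rintro ⟨k, rfl⟩
    rw [mul_comp, comp_assoc, c1, comp_X]
    exact dvd_mul_right _ _
  · rintro ⟨k, hk⟩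
    refine ⟨k.comp (C (a : F) * X + C b), ?_⟩
    rw [← mul_comp, ← hk, comp_assoc, c2, comp_X]

/-- If the polynomials `q i` become pairwise coprime after the substitutions `X ↦ a i X + b i`,
then the direct sum of their companion matrices is a polynomial in the companion matrix of the
product of the transformed polynomials. -/
theorem exists_aeval_companion_similar {ι : Type*} [Fintype ι] [DecidableEq ι] {q : ι → F[X]}
    (hq : ∀ i, (q i).Monic) (a : ι → Fˣ) (b : ι → F)
    (hcop : Pairwise (Function.onFun IsCoprime fun i => omegaConj (q i) (Omega.mk (a i) (b i))))
    {f : F[X]} (hf : f = ∏ i, omegaConj (q i) (Omega.mk (a i) (b i))) :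
    ∃ g : F[X], MatrixSimilar (aeval (companion f) g)
      (Matrix.blockDiagonal' fun i => companion (q i)) := by
  set s : ι → F[X] := fun i => omegaConj (q i) (Omega.mk (a i) (b i)) with hs
  have hsm : ∀ i, (s i).Monic := fun i => monic_omegaConj (hq i) _ _
  have hfm : f.Monic := hf ▸ monic_prod_of_monic _ _ fun i _ => hsm i
  have hdvd : ∀ i, s i ∣ f := fun i => hf ▸ Finset.dvd_prod_of_mem s (Finset.mem_univ i)
  -- Chinese remainder theorem: `g ≡ a i X + b i` modulo each `s i`.
  obtain ⟨g, hg⟩ := Ideal.exists_forall_sub_mem_ideal (I := fun i => Ideal.span {s i})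
    (fun i j hij => (Ideal.isCoprime_span_singleton_iff _ _).2 (hcop hij))
    fun i => C (a i : F) * X + C (b i)
  refine ⟨g, ?_⟩
  let t : ι → F[X] := fun i => C (((a i)⁻¹ : Fˣ) : F) * X - C ((((a i)⁻¹ : Fˣ) : F) * b i)
  have hst : ∀ i (h : F[X]), s i ∣ h ↔ q i ∣ h.comp (t i) := fun i h => omegaConj_dvd_iff h _ _
  have hmk : ∀ i (h : F[X]), aeval (AdjoinRoot.mk (q i) (t i)) h =
      AdjoinRoot.mk (q i) (h.comp (t i)) := by
    intro i h
    rw [← AdjoinRoot.aeval_eq, ← AdjoinRoot.aeval_eq, aeval_comp]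
  -- The map `h ↦ h ∘ t i` is well defined because `s i ∣ f` translates into `q i ∣ f ∘ t i`.
  let Ψ : ∀ i, AdjoinRoot f →ₐ[F] AdjoinRoot (q i) := fun i =>
    AdjoinRoot.liftAlgHom f (Algebra.ofId _ _) (AdjoinRoot.mk (q i) (t i)) (by
      change aeval (AdjoinRoot.mk (q i) (t i)) f = 0
      rw [hmk, AdjoinRoot.mk_eq_zero, ← hst]
      exact hdvd i)
  have hΨ : ∀ i h, Ψ i (AdjoinRoot.mk f h) = AdjoinRoot.mk (q i) (h.comp (t i)) :=
    fun i h => hmk i h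
  have : ∀ i, FiniteDimensional F (AdjoinRoot (q i)) := fun i => (hq i).finite_adjoinRoot
  have : FiniteDimensional F (AdjoinRoot f) := hfm.finite_adjoinRoot
  let Λ : AdjoinRoot f →ₗ[F] (∀ i, AdjoinRoot (q i)) := LinearMap.pi fun i => (Ψ i).toLinearMap
  -- A class in the kernel is divisible by all the coprime `s i`, hence by `f`. As the dimensions
  -- agree, `Λ` is an isomorphism.
  have hinj : Function.Injective Λ := by
    rw [injective_iff_map_eq_zero]
    intro x hx
    obtain ⟨h, rfl⟩ := AdjoinRoot.mk_surjective x
    rw [AdjoinRoot.mk_eq_zero, hf]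
    refine Finset.prod_dvd_of_coprime (fun i _ j _ hij => hcop hij) fun i _ => (hst i h).2 ?_
    rw [← AdjoinRoot.mk_eq_zero, ← hΨ]
    exact congrFun hx i
  have hrank : ∀ {p : F[X]}, p.Monic → Module.finrank F (AdjoinRoot p) = p.natDegree := by
    intro p hp
    rw [Module.finrank_eq_card_basis (AdjoinRoot.powerBasis' hp).basis, Fintype.card_fin]; rfl
  have hdim : Module.finrank F (AdjoinRoot f) = Module.finrank F (∀ i, AdjoinRoot (q i)) := by
    rw [Module.finrank_pi_fintype, hrank hfm, hf, natDegree_prod_of_monic _ _ fun i _ => hsm i]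
    refine Finset.sum_congr rfl fun i _ => ?_
    rw [hrank (hq i), natDegree_omegaConj]
  let β : Module.Basis (Fin f.natDegree) F (AdjoinRoot f) := (AdjoinRoot.powerBasis' hfm).basis
  refine similar_of_linearEquiv _ _ hq
    (β.equivFun.symm.trans (LinearMap.linearEquivOfInjective Λ hinj hdim)) fun v i => ?_
  obtain ⟨x, rfl⟩ := β.equivFun.surjective v
  have h1 : (aeval (companion f) g).mulVec (β.equivFun x) =
      β.equivFun (AdjoinRoot.mk f g * x) := by
    rw [aeval_companion hfm]
    exact Algebra.leftMulMatrix_mulVec_repr β _ _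
  rw [h1]
  simp only [LinearEquiv.trans_apply, LinearEquiv.symm_apply_apply,
    LinearMap.linearEquivOfInjective_apply]
  change Ψ i (AdjoinRoot.mk f g * x) = _ * Ψ i x
  rw [map_mul, hΨ]
  congr 1
  -- Applying `t i` to the congruence for `g` gives `g ∘ t i ≡ X` modulo `q i`, so `Ψ i` sends the
  -- class of `g` to the root.
  have h2 : q i ∣ (g - (C (a i : F) * X + C (b i))).comp (t i) :=
    (hst i _).1 (Ideal.mem_span_singleton.1 (hg i))
  have h3 : (C (a i : F) * X + C (b i) : F[X]).comp (t i) = X := by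
    simp only [t, add_comp, mul_comp, C_comp, X_comp, mul_sub, ← mul_assoc, ← C_mul, Units.mul_inv]
    simp
  rw [sub_comp, h3, ← AdjoinRoot.mk_eq_zero, map_sub, sub_eq_zero] at h2
  rw [h2, AdjoinRoot.mk_X]

/-- Equal multisets of values mean that corresponding fibres have equal cardinality; bijections
between the fibres are glued together. -/
theorem exists_equiv_of_map_univ_eq {ι κ α : Type*} [Fintype ι] [Fintype κ] {u : ι → α}
    {v : κ → α} (h : Finset.univ.val.map u = Finset.univ.val.map v) :
    ∃ σ : ι ≃ κ, ∀ i, v (σ i) = u i := by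
  classical
  have hc : ∀ y, Fintype.card {i // u i = y} = Fintype.card {k // v k = y} := by
    intro y
    have := congrArg (Multiset.count y) h
    simp only [Multiset.count_map] at this
    rw [Fintype.card_subtype, Fintype.card_subtype]
    simpa [eq_comm, Finset.card_def] using this
  let σ : ι ≃ κ := (Equiv.sigmaFiberEquiv u).symm.trans
    ((Equiv.sigmaCongrRight fun y => Fintype.equivOfCardEq (hc y)).trans (Equiv.sigmaFiberEquiv v))
  exact ⟨σ, fun i => (Fintype.equivOfCardEq (hc (u i)) ⟨i, rfl⟩).2⟩

end LinearAlgebra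

/-! ### Counting conjugates and assembling the theorem -/

section Main

variable {F : Type u} [Field F]

/-- The case `S_p ≠ 0`, `T_p ≠ 1`, for which no bound is assumed, can occur only over an infinite
field, where the orbit is infinite. -/
theorem card_le_encard_omegaOrbit {n : ℕ} {A : Matrix (Fin n) (Fin n) F} {p : F[X]}
    (hp : Irreducible p)
    (h0 : addStabilizer p = {0} → (ell A p : ℕ∞) ≤ ENat.card F)
    (h1 : addStabilizer p ≠ {0} → mulStabilizer p = {1} → (ell A p : ℕ∞) ≤ ENat.card Fˣ) :
    (ell A p : ℕ∞) ≤ (omegaOrbit p).encard := by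
  rcases finite_or_infinite F with hF | hF
  · by_cases h : addStabilizer p = {0}
    · exact (h0 h).trans (card_le_encard_omegaOrbit_of_addStabilizer_eq_zero h)
    · have h' := mulStabilizer_eq_of_addStabilizer_ne hp h
      exact (h1 h h').trans (card_units_le_encard_omegaOrbit_of_mulStabilizer_eq_one h')
  · rw [(infinite_omegaOrbit hp.natDegree_pos.ne').encard_eq]
    exact le_top

/-- If `p j` lies in the orbit of `p i`, then `p j ^ e j` is one of the elementary divisors counted
by `ell A (p i)`. -/
theorem encard_orbit_fiber_le_ell {n m : ℕ} {A : Matrix (Fin n) (Fin n) F} {p : Fin m → F[X]}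
    {e : Fin m → ℕ} (hel : elementaryDivisors A = Finset.univ.val.map fun i => p i ^ e i)
    (i : Fin m) : {j | omegaOrbit (p j) = omegaOrbit (p i)}.encard ≤ ell A (p i) := by
  classical
  have h : {j | omegaOrbit (p j) = omegaOrbit (p i)} =
      ((Finset.univ.filter fun j => omegaOrbit (p j) = omegaOrbit (p i) : Finset (Fin m)) :
        Set (Fin m)) := by simp
  rw [h, Set.encard_coe_eq_coe_finsetCard, ell, hel, Multiset.countP_map]
  refine Nat.cast_le.2 (Multiset.card_le_card ?_)
  rw [Finset.filter_val]
  refine Multiset.monotone_filter_right _ fun j hj => ?_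
  have : p j ∈ omegaOrbit (p i) := hj ▸ ⟨Omega.mk 1 0, (omegaConj_one_zero _).symm⟩
  obtain ⟨M, hM⟩ := this
  exact ⟨M, e j, by rw [← hM]⟩

theorem exists_similar_aeval_companion {n : ℕ} {A : Matrix (Fin n) (Fin n) F}
    (hA : ∀ p : F[X], p.Monic → Irreducible p → p ∣ minpoly F A →
      (addStabilizer p = {0} → (ell A p : ℕ∞) ≤ ENat.card F) ∧
      (addStabilizer p ≠ {0} → mulStabilizer p = {1} → (ell A p : ℕ∞) ≤ ENat.card Fˣ))
    {m : ℕ} {p : Fin m → F[X]} {e : Fin m → ℕ}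
    (hp : ∀ i, (p i).Monic ∧ Irreducible (p i) ∧ p i ∣ minpoly F A)
    (hel : elementaryDivisors A = Finset.univ.val.map fun i => p i ^ e i) :
    ∃ (r : Fin m → F[X]) (g : F[X]), (∀ i, ∃ M : Omega F, r i = omegaConj (p i) M) ∧
      (∀ i, (r i).Monic) ∧ Function.Injective r ∧
      MatrixSimilar A (aeval (companion (∏ i, r i ^ e i)) g) := by
  obtain ⟨r, hr, hmem⟩ := exists_injective_mem_of_encard_le (fun i => omegaOrbit (p i))
    (fun i j x hi hj => (omegaOrbit_eq_of_mem hi).symm.trans (omegaOrbit_eq_of_mem hj))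
    fun i => (encard_orbit_fiber_le_ell hel i).trans
      (card_le_encard_omegaOrbit (hp i).2.1 (hA _ (hp i).1 (hp i).2.1 (hp i).2.2).1
        (hA _ (hp i).1 (hp i).2.1 (hp i).2.2).2)
  have hmem' := fun i => mem_omegaOrbit.1 (hmem i)
  choose a b hab using hmem'
  have hrm : ∀ i, (r i).Monic := fun i => hab i ▸ monic_omegaConj (hp i).1 _ _
  have hri : ∀ i, Irreducible (r i) := fun i => hab i ▸ irreducible_omegaConj (hp i).2.1 _ _
  obtain ⟨m', q, hq, -, hsim⟩ := (isElementaryDivisors_iff A _).2 hel.symm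
  -- The decomposition behind `elementaryDivisors A` has its own indexing; `σ` matches it with the
  -- given `p i ^ e i`.
  obtain ⟨σ, hσ⟩ := exists_equiv_of_map_univ_eq hq.symm
  obtain rfl : q = fun k => p (σ k) ^ e (σ k) := funext fun k => (hσ k).symm
  have hpow : ∀ i, omegaConj (p i ^ e i) (Omega.mk (a i) (b i)) = r i ^ e i := fun i => by
    rw [← omegaConj_pow, ← hab]
  obtain ⟨g, hg⟩ := exists_aeval_companion_similar (q := fun k => p (σ k) ^ e (σ k))
    (fun k => (hp _).1.pow _) (fun k => a (σ k)) (fun k => b (σ k)) (f := ∏ i, r i ^ e i) (by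
      intro k l hkl
      simp only [Function.onFun, hpow]
      -- Distinct monic irreducible polynomials are coprime, and so are their powers.
      refine IsCoprime.pow (((hri _).coprime_iff_not_dvd).2 fun h => hkl (σ.injective (hr ?_)))
      exact eq_of_monic_of_associated (hrm _) (hrm _) ((hri _).associated_of_dvd (hri _) h)) (by
      simp only [hpow]
      exact (σ.prod_comp fun i => r i ^ e i).symm)
  exact ⟨r, g, hmem, hrm, hr, hsim.trans hg.symm⟩

/-- If `A = P g(C_f) P⁻¹`, then `A = g(P C_f P⁻¹)`, and `P C_f P⁻¹` is cyclic. -/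
theorem isPolynomialType_of_similar {n : ℕ} {A : Matrix (Fin n) (Fin n) F} {f g : F[X]}
    (hf : f.Monic) (h : MatrixSimilar A (aeval (companion f) g)) : IsPolynomialType A := by
  obtain ⟨P, Q, h1, h2, h3⟩ := h
  have hB : MatrixSimilar (P * companion f * Q) (companion f) := ⟨P, Q, h1, h2, rfl⟩
  -- `P` is a priori rectangular; its invertibility gives `deg f = n`.
  have hn := Matrix.square_of_invertible P Q h1 h2
  rw [Fintype.card_fin, Fintype.card_fin] at hn
  refine ⟨P * companion f * Q, g, ⟨f, hf, hn.symm, hB⟩, ?_⟩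
  rw [h3, aeval_conj h1 h2]

end Main

end PolynomialType

open PolynomialType
theorem theorem3p3 {F : Type*} [Field F] {n : ℕ} (A : Matrix (Fin n) (Fin n) F)
    (hA : ∀ p : F[X], p.Monic → Irreducible p → p ∣ minpoly F A →
      (addStabilizer p = {0} → (ell A p : ℕ∞) ≤ ENat.card F) ∧
      (addStabilizer p ≠ {0} → mulStabilizer p = {1} → (ell A p : ℕ∞) ≤ ENat.card Fˣ)) :
    IsPolynomialType A ∧
    ∀ (m : ℕ) (p : Fin m → F[X]) (e : Fin m → ℕ),
      (∀ i, (p i).Monic ∧ Irreducible (p i) ∧ p i ∣ minpoly F A ∧ 0 < e i) →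
      elementaryDivisors A = Finset.univ.val.map (fun i => p i ^ e i) →
      ∃ (r : Fin m → F[X]) (g : F[X]),
        (∀ i, ∃ M : Omega F, r i = omegaConj (p i) M) ∧
        Function.Injective r ∧
        MatrixSimilar A (aeval (companion (∏ i, r i ^ e i)) g) := by
  constructor
  · obtain ⟨m, q, hel, hq, hsim⟩ := (isElementaryDivisors_iff A _).2 rfl
    choose p e hpm hpi he hpe using hq
    -- Since `e i > 0`, `p i` divides `q i`, which divides the minimal polynomial; this makes `hA`
    -- applicable to `p i`.
    have hdvd : ∀ i, p i ∣ minpoly F A := fun i =>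
      (dvd_pow_self (p i) (he i).ne').trans
        (hpe i ▸ dvd_minpoly_of_similar (fun i => hpe i ▸ (hpm i).pow _) hsim i)
    obtain ⟨r, g, -, hrm, -, h⟩ := exists_similar_aeval_companion (e := e) hA
      (fun i => ⟨hpm i, hpi i, hdvd i⟩) (hel.trans (by simp only [hpe]))
    exact isPolynomialType_of_similar (monic_prod_of_monic _ _ fun i _ => (hrm i).pow _) h
  · intro m p e hp hel
    obtain ⟨r, g, h1, -, h2, h3⟩ := exists_similar_aeval_companion hA
      (fun i => ⟨(hp i).1, (hp i).2.1, (hp i).2.2.1⟩) hel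
    exact ⟨r, g, h1, h2, h3⟩
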